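/- Let $\mathbb L^{n+2}=\mathbb R\times\mathbb R^{n+1}$ carry the Lorentzian metric $-dt^2+dx_1^2+\dots+dx_{n+1}^2$. Let $r$ be an admissible function, i.e. a smooth function on an open interval $J\ni 0$ with $r>0$ and $|r'|<1$ on $J$, and let $$Q(r)=\{(t,x)\in J\times\mathbb R^{n+1} : \|x\|^2=r(t)^2\}\subset\mathbb L^{n+2}$$ with the induced Lorentzian metric. Put $\alpha(t)=\dfrac{-1}{r(t)\sqrt{1-r'(t)^2}}$, and let $N(t,x)=\dfrac{1}{r(t)\sqrt{1-r'(t)^2}}\big(r'(t)r(t),x\big)$ be the unit normal vector field of $Q(r)$. Let $M^k$ be a smooth $k$-dimensional manifold and $\Psi=(\Psi_0,\Psi_1,\dots,\Psi_{n+1})\colon M^k\to Q(r)$ a smooth spacelike immersion, i.e. an immersion whose induced metric on $M^k$ is Riemannian. Let $\Delta$ (the trace of the Hessian, applied componentwise to $\mathbb L^{n+2}$-valued maps), $\nabla$ and $\|\cdot\|$ be the Laplacian, gradient and norm of the induced metric. Then $\Psi$ is stationary, i.e. its mean curvature vector field as an immersion into $Q(r)$ vanishes identically, if and only if $$\Delta\Psi=\alpha(\Psi_0)\Big[k-\big(r''(\Psi_0)r(\Psi_0)+r'(\Psi_0)^2-1\big)\|\nabla\Psi_0\|^2\Big]\,N$$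 on $M^k$, where $N$ is evaluated along $\Psi$. Equivalently, $\Psi$ is stationary if and only if $$\Delta\Psi+q_{\Psi_0}\,\mathbf P=0$$ on $M^k$, where $\mathbf P=\big(r(\Psi_0)r'(\Psi_0),\Psi_1,\dots,\Psi_{n+1}\big)$ and $$q_{\Psi_0}=\frac{k-\big(r''(\Psi_0)r(\Psi_0)+r'(\Psi_0)^2-1\big)\|\nabla\Psi_0\|^2}{r(\Psi_0)^2\,(1-r'(\Psi_0)^2)}.$$ -/

import Mathlib

open scoped Manifold ContDiff InnerProductSpace

noncomputable section

namespace RWSpacetime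

/-! ### Semi-Riemannian geometry of manifolds without boundary -/

section General

variable {E : Type*} [NormedAddCommGroup E] [NormedSpace ℝ E]
  {E' : Type*} [NormedAddCommGroup E'] [NormedSpace ℝ E']

/-- The Christoffel map `Γ_y(u, v)` of a metric `G` given in coordinates: the vector `z` with
`G_y(z, w) = (1/2) * (∂_u G(v, w) + ∂_v G(u, w) - ∂_w G(u, v))` for all `w`. With `u`, `v` basis
vectors this is `Γ^l_{ij} = (1/2) g^{lm} (∂_i g_{jm} + ∂_j g_{im} - ∂_m g_{ij})`, that is, the
coordinate expression of the Levi-Civita connection of `G`. -/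
def christoffel (G : E → E →L[ℝ] E →L[ℝ] ℝ) (y u v : E) : E :=
  (G y).inverse ((1 / 2 : ℝ) •
    (fderiv ℝ G y u v + fderiv ℝ G y v u - ((fderiv ℝ G y).flip u).flip v))

variable (E) in
/-- A field of bilinear forms on the tangent spaces of a manifold `M` modelled on `E`. The tangent
space `TangentSpace 𝓘(ℝ, E) x` is `E` by definition. -/
abbrev MetricField (M : Type*) := M → E →L[ℝ] E →L[ℝ] ℝ

variable {M : Type*} [TopologicalSpace M] [ChartedSpace E M]
  {N : Type*} [TopologicalSpace N] [ChartedSpace E' N]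

/-- The metric `F^* h` on `M` induced by a map `F : M → N`. -/
def pullbackMetric (h : MetricField E' N) (F : M → N) : MetricField E M := fun x =>
  let A : E →L[ℝ] E' := mfderiv 𝓘(ℝ, E) 𝓘(ℝ, E') F x
  (h (F x)).bilinearComp A A

/-- The coordinate expression of `g` in the preferred chart at `x`. -/
def metricInChart (g : MetricField E M) (x : M) : E → E →L[ℝ] E →L[ℝ] ℝ :=
  pullbackMetric (M := E) g (extChartAt 𝓘(ℝ, E) x).symm

/-- The second fundamental form `(∇dF)_x(u, v) = ∇ᴺ_u (dF v) - dF (∇ᴹ_u v)` of a map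
`F : (M, g) → (N, h)`, for the Levi-Civita connections of `g` and `h`, computed in the preferred
charts at `x` and at `F x`, in which `T_x M` is identified with `E` and `T_{F x} N` with `E'`:
`∂_u ∂_v F + Γᴺ(∂_u F, ∂_v F) - dF (Γᴹ(u, v))`. When `F` is an isometric immersion this is the usual
second fundamental form, the component of `∇ᴺ_u (dF v)` normal to `M`. -/
def secondFundamentalForm (g : MetricField E M) (h : MetricField E' N) (F : M → N) (x : M)
    (u v : E) : TangentSpace 𝓘(ℝ, E') (F x) :=
  let F' : E → E' := writtenInExtChartAt 𝓘(ℝ, E) 𝓘(ℝ, E') x F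
  let y : E := extChartAt 𝓘(ℝ, E) x x
  (fderiv ℝ (fderiv ℝ F') y u v
    + christoffel (metricInChart h (F x)) (F' y) (fderiv ℝ F' y u) (fderiv ℝ F' y v)
    - fderiv ℝ F' y (christoffel (metricInChart g x) y u v) : E')

/-- The Hessian at `x` of a function `f` on `(M, g)` with values in a normed space (componentwise):
`∂_u ∂_v f - df (Γ(u, v))` in the preferred chart at `x`. -/
def hessian (g : MetricField E M) (f : M → E') (x : M) (u v : E) : E' :=
  let f' : E → E' := f ∘ (extChartAt 𝓘(ℝ, E) x).symm
  let y : E := extChartAt 𝓘(ℝ, E) x x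
  fderiv ℝ (fderiv ℝ f') y u v - fderiv ℝ f' y (christoffel (metricInChart g x) y u v)

/-- The gradient `∇f` of a function `f` on `(M, g)`: the vector with `g(∇f, v) = df(v)`. -/
def gradient (g : MetricField E M) (f : M → ℝ) (x : M) : TangentSpace 𝓘(ℝ, E) x :=
  (g x).inverse (mfderiv 𝓘(ℝ, E) 𝓘(ℝ, ℝ) f x)

/-- `‖∇f‖²`. -/
def gradientNormSq (g : MetricField E M) (f : M → ℝ) (x : M) : ℝ :=
  g x (gradient g f x) (gradient g f x)

end General

section Trace

variable {k : ℕ} {M : Type*} [TopologicalSpace M] [ChartedSpace (EuclideanSpace ℝ (Fin k)) M]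
  {W : Type*} [NormedAddCommGroup W] [NormedSpace ℝ W]

/-- The trace `∑ g^{ij} B(b_i, b_j)` of `B` with respect to the inner product `g` on
`E = EuclideanSpace ℝ (Fin k)`. Here `(b_i)` is the standard basis and `g.inverse (proj i)` is
`∑_j g^{ij} b_j`, the vector that `g` makes dual to the `i`-th coordinate function. -/
def metricTrace {W : Type*} [AddCommMonoid W]
    (g : EuclideanSpace ℝ (Fin k) →L[ℝ] EuclideanSpace ℝ (Fin k) →L[ℝ] ℝ)
    (B : EuclideanSpace ℝ (Fin k) → EuclideanSpace ℝ (Fin k) → W) : W :=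
  ∑ i : Fin k, B (EuclideanSpace.single i 1)
    (g.inverse (EuclideanSpace.proj i : EuclideanSpace ℝ (Fin k) →L[ℝ] ℝ))

/-- The Laplacian `Δf = trace_g (Hess f)` of a function with values in a normed space. -/
def laplacian (g : MetricField (EuclideanSpace ℝ (Fin k)) M) (f : M → W) (x : M) : W :=
  metricTrace (g x) (hessian g f x)

variable {E' : Type*} [NormedAddCommGroup E'] [NormedSpace ℝ E']
  {N : Type*} [TopologicalSpace N] [ChartedSpace E' N]

/-- The mean curvature vector `(1/k) trace_g σ` at `x` of an immersion `F : M → (N, h)`, where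
`g = F^* h` is the induced metric and `σ` the second fundamental form. -/
def meanCurvatureVector (h : MetricField E' N) (F : M → N) (x : M) :
    TangentSpace 𝓘(ℝ, E') (F x) :=
  ((1 / k : ℝ) • metricTrace (pullbackMetric (E := EuclideanSpace ℝ (Fin k)) h F x)
    (secondFundamentalForm (pullbackMetric h F) h F x) : E')

end Trace

/-! ### Lorentz-Minkowski spacetime and the rotation hypersurface `Q(r)` -/

/-- The vector space `ℝ × ℝ^{n+1}` underlying the Lorentz-Minkowski spacetime `L^{n+2}`. -/
abbrev Minkowski (n : ℕ) := ℝ × EuclideanSpace ℝ (Fin (n + 1))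

/-- The Lorentzian product `-t t' + ⟨x, x'⟩` on `L^{n+2}`. -/
def lorentz (n : ℕ) : Minkowski n →L[ℝ] Minkowski n →L[ℝ] ℝ :=
  (innerSL ℝ (E := EuclideanSpace ℝ (Fin (n + 1)))).bilinearComp
      (ContinuousLinearMap.snd ℝ _ _) (ContinuousLinearMap.snd ℝ _ _)
    - (ContinuousLinearMap.mul ℝ ℝ).bilinearComp
      (ContinuousLinearMap.fst ℝ _ _) (ContinuousLinearMap.fst ℝ _ _)

theorem lorentz_apply (n : ℕ) (z w : Minkowski n) :
    lorentz n z w = -(z.1 * w.1) + ⟪z.2, w.2⟫_ℝ := by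
  simp [lorentz]; ring

/-- The flat metric of `L^{n+2}`. -/
def lorentzMetric (n : ℕ) : MetricField (Minkowski n) (Minkowski n) := fun _ => lorentz n

/-- An admissible function: a smooth function `r` on an open interval `J` containing `0` with
`r > 0` and `|r'| < 1` on `J`. The values of `toFun` outside `J` are irrelevant. -/
structure AdmissibleFunction where
  /-- the interval `J` -/
  domain : TopologicalSpace.Opens ℝ
  ordConnected : (domain : Set ℝ).OrdConnected
  zero_mem : (0 : ℝ) ∈ domain
  /-- the function `r` -/
  toFun : ℝ → ℝ
  contDiffOn : ContDiffOn ℝ ∞ toFun domain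
  pos : ∀ t ∈ domain, 0 < toFun t
  abs_deriv_lt : ∀ t ∈ domain, |deriv toFun t| < 1

instance : CoeFun AdmissibleFunction (fun _ => ℝ → ℝ) := ⟨AdmissibleFunction.toFun⟩

/-- The rotation hypersurface `Q(r) = {(t, x) ∈ J × ℝ^{n+1} : ‖x‖² = r(t)²}` of `L^{n+2}`. -/
def Q (n : ℕ) (r : AdmissibleFunction) : Set (Minkowski n) :=
  {z | z.1 ∈ r.domain ∧ ‖z.2‖ ^ 2 = r z.1 ^ 2}

section Manifold

variable {n : ℕ} {r : AdmissibleFunction}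

theorem norm_eq_of_mem_Q {z : Minkowski n} (hz : z ∈ Q n r) : ‖z.2‖ = r z.1 :=
  (sq_eq_sq₀ (norm_nonneg _) (r.pos _ hz.1).le).1 hz.2

variable (n r) in
/-- The homeomorphism `Q(r) ≃ J × S^n` with inverse `(t, p) ↦ (t, r(t) p)`. -/
def Q.homeomorph :
    Q n r ≃ₜ r.domain × Metric.sphere (0 : EuclideanSpace ℝ (Fin (n + 1))) 1 where
  toFun z := (⟨z.1.1, z.2.1⟩, ⟨(r z.1.1)⁻¹ • z.1.2, by
    have h := r.pos _ z.2.1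
    simp [norm_smul, norm_eq_of_mem_Q z.2, abs_of_pos h, h.ne']⟩)
  invFun w := ⟨(w.1.1, r w.1.1 • w.2.1), w.1.2, by
    have h : ‖w.2.1‖ = 1 := by simp
    simp [norm_smul, h]⟩
  left_inv z := by
    have h := r.pos _ z.2.1
    ext1
    refine Prod.ext rfl ?_
    simp [smul_smul, h.ne']
  right_inv w := by
    have h := r.pos _ w.1.2
    refine Prod.ext rfl ?_
    ext1
    simp [smul_smul, h.ne']
  continuous_toFun := by
    have hr : Continuous fun z : Q n r => r z.1.1 :=
      r.contDiffOn.continuousOn.comp_continuous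
        (continuous_fst.comp continuous_subtype_val) (fun z => z.2.1)
    refine Continuous.prodMk ?_ ?_
    · exact (continuous_fst.comp continuous_subtype_val).subtype_mk _
    · refine Continuous.subtype_mk ?_ _
      exact (hr.inv₀ fun z => (r.pos _ z.2.1).ne').smul
        (continuous_snd.comp continuous_subtype_val)
  continuous_invFun := by
    have hr : Continuous fun t : r.domain => r t.1 :=
      r.contDiffOn.continuousOn.comp_continuous continuous_subtype_val (fun t => t.2)
    refine Continuous.subtype_mk ?_ _
    exact (continuous_subtype_val.comp continuous_fst).prodMk
      ((hr.comp continuous_fst).smul (continuous_subtype_val.comp continuous_snd))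

/-- The smooth structure of `Q(r)`: its charts are those of `J × S^n`, composed with the
diffeomorphism `Q(r) ≃ J × S^n`. -/
instance Q.instChartedSpace : ChartedSpace (ℝ × EuclideanSpace ℝ (Fin n)) (Q n r) where
  atlas := (Q.homeomorph n r).transOpenPartialHomeomorph ''
    atlas (ModelProd ℝ (EuclideanSpace ℝ (Fin n)))
      (r.domain × Metric.sphere (0 : EuclideanSpace ℝ (Fin (n + 1))) 1)
  chartAt z := (Q.homeomorph n r).transOpenPartialHomeomorph
    (chartAt (ModelProd ℝ (EuclideanSpace ℝ (Fin n))) (Q.homeomorph n r z))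
  mem_chart_source z :=
    mem_chart_source (ModelProd ℝ (EuclideanSpace ℝ (Fin n))) (Q.homeomorph n r z)
  chart_mem_atlas _ := ⟨_, chart_mem_atlas _ _, rfl⟩

instance Q.instIsManifold :
    IsManifold 𝓘(ℝ, ℝ × EuclideanSpace ℝ (Fin n)) ∞ (Q n r) := by
  refine @IsManifold.mk _ _ _ _ _ _ _ _ _ _ _ _ ⟨?_⟩
  rintro _ _ ⟨c, hc, rfl⟩ ⟨c', hc', rfl⟩
  have h := HasGroupoid.compatible (G := contDiffGroupoid ∞ (𝓘(ℝ, ℝ).prod (𝓡 n))) hc hc'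
  rw [← modelWithCornersSelf_prod] at h
  have e : ((Q.homeomorph n r).transOpenPartialHomeomorph c).symm ≫ₕ
      (Q.homeomorph n r).transOpenPartialHomeomorph c' = c.symm ≫ₕ c' := by
    ext x <;> simp
  rw [e]
  exact h

variable (n r) in
/-- The Lorentzian metric that `Q(r)` inherits from `L^{n+2}`. -/
def Q.metric : MetricField (ℝ × EuclideanSpace ℝ (Fin n)) (Q n r) :=
  pullbackMetric (lorentzMetric n) (Subtype.val : Q n r → Minkowski n)

end Manifold

/-- `α(t) = -1 / (r √(1 - r'²))`. -/
def alpha (r : AdmissibleFunction) (t : ℝ) : ℝ :=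
  -1 / (r t * √(1 - deriv r t ^ 2))

/-- The unit normal vector field `N(t, x) = (r' r, x) / (r √(1 - r'²))` of `Q(r)`. -/
def unitNormal {n : ℕ} (r : AdmissibleFunction) (z : Minkowski n) : Minkowski n :=
  (1 / (r z.1 * √(1 - deriv r z.1 ^ 2))) • (deriv r z.1 * r z.1, z.2)

/-- The vector field `P(t, x) = (r r', x)`. -/
def fieldP {n : ℕ} (r : AdmissibleFunction) (z : Minkowski n) : Minkowski n :=
  (r z.1 * deriv r z.1, z.2)

section Immersions

variable {n k : ℕ} {r : AdmissibleFunction}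
  {M : Type*} [TopologicalSpace M] [ChartedSpace (EuclideanSpace ℝ (Fin k)) M]

variable (k) in
/-- The metric that a map `Ψ : M → Q(r)` induces on `M`. -/
def inducedMetric (Ψ : M → Q n r) : MetricField (EuclideanSpace ℝ (Fin k)) M :=
  pullbackMetric (Q.metric n r) Ψ

variable (k) in
/-- `Ψ` is smooth and its induced metric is Riemannian (in particular `dΨ` is injective). -/
structure IsSpacelikeImmersion (Ψ : M → Q n r) : Prop where
  contMDiff : ContMDiff (𝓡 k) 𝓘(ℝ, ℝ × EuclideanSpace ℝ (Fin n)) ∞ Ψ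
  injective_mfderiv : ∀ x : M,
    Function.Injective (mfderiv (𝓡 k) 𝓘(ℝ, ℝ × EuclideanSpace ℝ (Fin n)) Ψ x)
  pos_def : ∀ (x : M) (v : TangentSpace (𝓡 k) x), v ≠ 0 → 0 < inducedMetric k Ψ x v v

variable (k) in
/-- The mean curvature vector field of `Ψ` in `Q(r)` vanishes. -/
def IsStationaryImmersion (Ψ : M → Q n r) : Prop :=
  ∀ x : M, meanCurvatureVector (k := k) (Q.metric n r) Ψ x = 0

/-- `Ψ` as a map to `L^{n+2}`. -/
def position (Ψ : M → Q n r) : M → Minkowski n := fun x => (Ψ x : Minkowski n)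

/-- The component `Ψ_0`. -/
def timeComponent (Ψ : M → Q n r) : M → ℝ := fun x => (position Ψ x).1

variable (k) in
/-- `q_{Ψ_0} = (k - (r'' r + r'² - 1)(Ψ_0) ‖∇Ψ_0‖²) / (r(Ψ_0)² (1 - r'(Ψ_0)²))`. -/
def qFunction (Ψ : M → Q n r) (x : M) : ℝ :=
  (k - (deriv (deriv r) (timeComponent Ψ x) * r (timeComponent Ψ x)
      + deriv r (timeComponent Ψ x) ^ 2 - 1)
    * gradientNormSq (inducedMetric k Ψ) (timeComponent Ψ) x)
  / (r (timeComponent Ψ x) ^ 2 * (1 - deriv r (timeComponent Ψ x) ^ 2))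

end Immersions

end RWSpacetime

end

/-! Write locally `Ψ = ι ∘ F`, with `ι` the chart parametrization of `Q(r)` in Minkowski space and
`F` the coordinate expression of `Ψ`. The chain rule splits the Hessian of the position vector into
`dι` of the second fundamental form of `Ψ` in `Q(r)`, plus the second fundamental form of `Q(r)`
evaluated on `dΨ` (`IsSpacelikeImmersion.hessian_position`).

The latter is explicit. `P` is half the Lorentz gradient of `‖x‖² - r(t)²`, hence normal to `Q(r)`,
and `⟨P, P⟩ = r²(1 - r'²) > 0`. By the Gauss formula `D²ι(a, b) - Dι(Γ(a, b))` is normal, so it is a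
multiple of `P`; differentiating `⟨P, Dι b⟩ = 0` gives the coefficient
(`Q.second_fundamental_form`).

Taking the trace, the metric contributes `k` and `dΨ₀ ⊗ dΨ₀` contributes `‖∇Ψ₀‖²`, so `ΔΨ = dι(tr σ)
- q P` (`IsSpacelikeImmersion.laplacian_position`). As `dι` is injective, `tr σ = 0` iff `ΔΨ + q P =
0`. The form with `N` follows from `N = -α P`. -/

namespace RWSpacetime

/-! ### Gauss formula and metric traces -/

section General

variable {E : Type*} [NormedAddCommGroup E] [NormedSpace ℝ E]
  {W : Type*} [NormedAddCommGroup W] [NormedSpace ℝ W]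

/-- A nondegenerate bilinear form on a finite-dimensional space is invertible. -/
theorem bilin_apply_inverse [FiniteDimensional ℝ E] (g : E →L[ℝ] E →L[ℝ] ℝ)
    (hg : ∀ u, (∀ v, g u v = 0) → u = 0) (φ : E →L[ℝ] ℝ) : g (g.inverse φ) = φ := by
  have hinj : Function.Injective g.toLinearMap := by
    rw [← LinearMap.ker_eq_bot, LinearMap.ker_eq_bot']
    intro u hu
    exact hg u fun v => by
      have : g u = 0 := hu
      simp [this]
  have hfin : Module.finrank ℝ E = Module.finrank ℝ (E →L[ℝ] ℝ) := by
    rw [← (LinearMap.toContinuousLinearMap (𝕜 := ℝ) (E := E) (F' := ℝ)).finrank_eq]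
    exact (Subspace.dual_finrank_eq (K := ℝ) (V := E)).symm
  let e : E ≃L[ℝ] (E →L[ℝ] ℝ) :=
    (LinearEquiv.ofInjectiveOfFinrankEq g.toLinearMap hinj hfin).toContinuousLinearEquiv
  have he : (e : E →L[ℝ] (E →L[ℝ] ℝ)) = g := by ext u v; rfl
  rw [← he, ContinuousLinearMap.inverse_equiv]
  simp

/-- The Gauss formula: the normal part of the second derivative of an isometric immersion `f` into
a flat space is `D²f(a, b) - Df(Γ(a, b))`. -/
theorem gauss_formula [FiniteDimensional ℝ E] {B : W →L[ℝ] W →L[ℝ] ℝ}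
    (hB : ∀ z w, B z w = B w z)
    {f : E → W} {y : E} (hf : ContDiffAt ℝ 2 f y) {G : E → E →L[ℝ] E →L[ℝ] ℝ}
    (hG : G =ᶠ[nhds y] fun z => B.bilinearComp (fderiv ℝ f z) (fderiv ℝ f z))
    (hnd : ∀ u, (∀ v, G y u v = 0) → u = 0) (a b w : E) :
    B (fderiv ℝ (fderiv ℝ f) y a b - fderiv ℝ f y (christoffel G y a b)) (fderiv ℝ f y w) = 0 := by
  have hd : DifferentiableAt ℝ (fderiv ℝ f) y :=
    (hf.fderiv_right (m := 1) (by norm_num)).differentiableAt (by norm_num)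
  -- Product rule for `G = B(Df, Df)`. In the Koszul combination of three such derivatives, symmetry
  -- of `D²f` and of `B` leaves `2 B(D²f(a, b), Df w)`.
  have key : ∀ u v w, fderiv ℝ G y u v w =
      B (fderiv ℝ (fderiv ℝ f) y u v) (fderiv ℝ f y w)
        + B (fderiv ℝ f y v) (fderiv ℝ (fderiv ℝ f) y u w) := by
    intro u v w
    have hGd : DifferentiableAt ℝ G y := by
      refine DifferentiableAt.congr_of_eventuallyEq ?_ hG
      -- As a composition of continuous linear maps, the form is differentiable by `clm_comp`.
      have : (fun z => B.bilinearComp (fderiv ℝ f z) (fderiv ℝ f z)) =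
          fun z => ((ContinuousLinearMap.compL ℝ E W ℝ).flip (fderiv ℝ f z)).comp
            (B.comp (fderiv ℝ f z)) := by
        funext z; ext; rfl
      rw [this]
      exact ((((ContinuousLinearMap.compL ℝ E W ℝ).flip).hasFDerivAt.comp y
        hd.hasFDerivAt).differentiableAt).clm_comp ((differentiableAt_const B).clm_comp hd)
    have h1 : HasFDerivAt (fun z => G z v w) _ y :=
      (hGd.hasFDerivAt.clm_apply (hasFDerivAt_const v y)).clm_apply (hasFDerivAt_const w y)
    have h3 : ∀ v, HasFDerivAt (fun z => fderiv ℝ f z v)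
        ((ContinuousLinearMap.apply ℝ W v).comp (fderiv ℝ (fderiv ℝ f) y)) y := fun v =>
      (ContinuousLinearMap.apply ℝ W v).hasFDerivAt.comp y hd.hasFDerivAt
    have h2 := B.hasFDerivAt_of_bilinear (h3 v) (h3 w)
    have h4 := h1.congr_of_eventuallyEq
      (hG.symm.mono fun z hz => show B (fderiv ℝ f z v) (fderiv ℝ f z w) = G z v w by
        rw [← hz]; rfl)
    have := congrArg (fun l : E →L[ℝ] ℝ => l u) (h4.unique h2)
    simp at this
    rw [this]; ring
  have hsymm : ∀ u v, fderiv ℝ (fderiv ℝ f) y u v = fderiv ℝ (fderiv ℝ f) y v u := fun u v =>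
    (hf.isSymmSndFDerivAt (by simp)) u v
  have h := congrArg (fun l : E →L[ℝ] ℝ => l w) (bilin_apply_inverse (G y) hnd ((1 / 2 : ℝ) •
    (fderiv ℝ G y a b + fderiv ℝ G y b a - ((fderiv ℝ G y).flip a).flip b)))
  change G y (christoffel G y a b) w = _ at h
  rw [hG.eq_of_nhds] at h
  simp [key] at h
  rw [map_sub, sub_apply, h, hsymm b a, hsymm w a, hsymm w b,
    hB (fderiv ℝ f y a), hB (fderiv ℝ f y b), hB _ (fderiv ℝ f y b)]
  ring

/-- By symmetry each summand is `proj i` applied to the `i`-th basis vector, that is `1`. This is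
the source of `k` in the theorem. -/
theorem metricTrace_self {k : ℕ}
    (g : EuclideanSpace ℝ (Fin k) →L[ℝ] EuclideanSpace ℝ (Fin k) →L[ℝ] ℝ)
    (hsymm : ∀ u v, g u v = g v u) (hg : ∀ u, (∀ v, g u v = 0) → u = 0) :
    metricTrace g (fun u v => g u v) = k := by
  simp only [metricTrace]
  simp_rw [hsymm (EuclideanSpace.single _ 1), bilin_apply_inverse g hg]
  simp

/-- Expanding `φ` in the coordinate functions, both sides become `φ (g.inverse φ)`. With `φ = dΨ₀`
this produces `‖∇Ψ₀‖²`. -/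
theorem metricTrace_mul_self {k : ℕ}
    (g : EuclideanSpace ℝ (Fin k) →L[ℝ] EuclideanSpace ℝ (Fin k) →L[ℝ] ℝ)
    (hg : ∀ u, (∀ v, g u v = 0) → u = 0) (φ : EuclideanSpace ℝ (Fin k) →L[ℝ] ℝ) :
    metricTrace g (fun u v => φ u * φ v) = g (g.inverse φ) (g.inverse φ) := by
  have hφ : φ = ∑ i, φ (EuclideanSpace.single i 1) •
      (EuclideanSpace.proj i : EuclideanSpace ℝ (Fin k) →L[ℝ] ℝ) := by
    ext v
    conv_lhs => rw [← (EuclideanSpace.basisFun (Fin k) ℝ).sum_repr v]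
    simp [mul_comm]
  have hinv : g.inverse φ = ∑ i, φ (EuclideanSpace.single i 1) •
      g.inverse (EuclideanSpace.proj i : EuclideanSpace ℝ (Fin k) →L[ℝ] ℝ) := by
    conv_lhs => rw [hφ]
    simp [map_sum]
  rw [bilin_apply_inverse g hg]
  conv_rhs => rw [hinv]
  simp [metricTrace]

/-! ### Normal vectors for the Lorentz product -/

theorem lorentz_symm (n : ℕ) (z w : Minkowski n) : lorentz n z w = lorentz n w z := by
  rw [lorentz_apply, lorentz_apply, real_inner_comm, mul_comm]

theorem lorentz_nondegenerate {n : ℕ} {z : Minkowski n} (h : ∀ w, lorentz n z w = 0) : z = 0 := by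
  have h1 := h (1, 0)
  have h2 := h (0, z.2)
  simp [lorentz_apply] at h1 h2
  exact Prod.ext h1 h2

/-- A hyperplane that is the range of an injective map and normal to a non-null vector `p`. -/
theorem eq_smul_of_lorentz_eq_zero {n : ℕ} {L : ℝ × EuclideanSpace ℝ (Fin n) →L[ℝ] Minkowski n}
    (hL : Function.Injective L) {p : Minkowski n} (hp : lorentz n p p ≠ 0)
    (hpL : ∀ a, lorentz n p (L a) = 0) {z : Minkowski n} (hz : ∀ a, lorentz n z (L a) = 0) :
    z = (lorentz n p z / lorentz n p p) • p := by
  have hrange : ∀ w, lorentz n p w = 0 → ∃ a, L a = w := by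
    have hle : LinearMap.range L.toLinearMap ≤ LinearMap.ker (lorentz n p).toLinearMap := by
      rintro _ ⟨a, rfl⟩
      exact hpL a
    have hsurj : Function.Surjective (lorentz n p).toLinearMap := fun c =>
      ⟨(c / lorentz n p p) • p, by simp [hp]⟩
    have h1 := LinearMap.finrank_range_add_finrank_ker (lorentz n p).toLinearMap
    rw [LinearMap.range_eq_top.2 hsurj] at h1
    have h2 := LinearMap.finrank_range_of_inj (f := L.toLinearMap) hL
    -- Both the range of `L` and the orthogonal complement of `p` have dimension `n + 1`.
    have heq := Submodule.eq_of_le_of_finrank_eq hle (by simp at h1 h2; omega)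
    intro w hw
    have : w ∈ LinearMap.range L.toLinearMap := heq ▸ hw
    exact this
  rw [← sub_eq_zero]
  set c := lorentz n p z / lorentz n p p
  -- The difference is orthogonal to `p` and to the range of `L`, which together span the space, so
  -- it vanishes by nondegeneracy.
  have hzp : lorentz n (z - c • p) p = 0 := by
    simp [c, hp, lorentz_symm n z p]
  have hzL : ∀ a, lorentz n (z - c • p) (L a) = 0 := fun a => by simp [hz, hpL]
  refine lorentz_nondegenerate fun w => ?_
  obtain ⟨a, ha⟩ := hrange (w - (lorentz n p w / lorentz n p p) • p) (by simp [hp])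
  have := hzL a
  rw [ha, map_sub, map_smul, hzp] at this
  simpa using this

end General

/-! ### The parametrization of `Q(r)` and its normal field -/

section Hypersurface

variable {n : ℕ} {r : AdmissibleFunction}

/-- The parametrization of `Q(r)` by the preferred chart at `p`. -/
noncomputable def Q.param (p : Q n r) (y : ℝ × EuclideanSpace ℝ (Fin n)) : Minkowski n :=
  ((extChartAt 𝓘(ℝ, ℝ × EuclideanSpace ℝ (Fin n)) p).symm y : Q n r)

/-- The inverse chart is a total function into `Q(r)`, so this needs no restriction to the chart
target. -/
theorem Q.param_mem (p : Q n r) (y : ℝ × EuclideanSpace ℝ (Fin n)) : Q.param p y ∈ Q n r :=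
  Subtype.property _

theorem Q.param_extChartAt (p : Q n r) :
    Q.param p (extChartAt 𝓘(ℝ, ℝ × EuclideanSpace ℝ (Fin n)) p p) = p := by
  rw [Q.param, extChartAt_to_inv]

/-- Only a germ: the inverse chart of `J` takes values in `J`, so it is the identity only near the
base point. Smoothness and injectivity of the differential are read off this formula. -/
theorem Q.param_eventuallyEq (p : Q n r) :
    Q.param p =ᶠ[nhds (extChartAt 𝓘(ℝ, ℝ × EuclideanSpace ℝ (Fin n)) p p)] fun y =>
      (y.1, r y.1 •
        ((extChartAt (𝓡 n) (Q.homeomorph n r p).2).symm y.2 : EuclideanSpace ℝ (Fin (n + 1)))) := by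
  have h := TopologicalSpace.Opens.chartAt_subtype_val_symm_eventuallyEq (H := ℝ) r.domain
    (x := (Q.homeomorph n r p).1)
  have h2 : Filter.Tendsto Prod.fst (nhds (extChartAt 𝓘(ℝ, ℝ × EuclideanSpace ℝ (Fin n)) p p))
      (nhds (chartAt ℝ ((Q.homeomorph n r p).1 : ℝ) ((Q.homeomorph n r p).1 : ℝ))) :=
    continuous_fst.continuousAt
  filter_upwards [h2.eventually h] with y hy
  have hy' : y.1 = (((chartAt ℝ (Q.homeomorph n r p).1).symm y.1 : r.domain) : ℝ) := hy
  refine Prod.ext hy'.symm ?_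
  change r (((chartAt ℝ (Q.homeomorph n r p).1).symm y.1 : r.domain) : ℝ) • _ = r y.1 • _
  rw [← hy']
  rfl

theorem AdmissibleFunction.contDiffAt {t : ℝ} (ht : t ∈ r.domain) : ContDiffAt ℝ ∞ r t :=
  r.contDiffOn.contDiffAt (r.domain.isOpen.mem_nhds ht)

theorem AdmissibleFunction.deriv_differentiableAt {t : ℝ} (ht : t ∈ r.domain) :
    DifferentiableAt ℝ (deriv r) t := by
  have h2 : DifferentiableOn ℝ (deriv r) r.domain := by
    have := ((contDiffOn_infty_iff_deriv_of_isOpen r.domain.isOpen).1 r.contDiffOn).2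
    exact this.differentiableOn (by simp)
  exact h2.differentiableAt (r.domain.isOpen.mem_nhds ht)

theorem contDiffAt_sphere_chart_symm (s : Metric.sphere (0 : EuclideanSpace ℝ (Fin (n + 1))) 1) :
    ContDiffAt ℝ ∞ (fun w => ((extChartAt (𝓡 n) s).symm w : EuclideanSpace ℝ (Fin (n + 1))))
      (extChartAt (𝓡 n) s s) := by
  have : Fact (Module.finrank ℝ (EuclideanSpace ℝ (Fin (n + 1))) = n + 1) := ⟨by simp⟩
  have h := (contMDiffAt_iff.1 (contMDiff_coe_sphere (E := EuclideanSpace ℝ (Fin (n + 1)))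
    (n := n) (m := ∞) s)).2
  simp only [modelWithCornersSelf_coe, Set.range_id, contDiffWithinAt_univ] at h
  exact h

theorem fderiv_sphere_chart_symm_injective
    (s : Metric.sphere (0 : EuclideanSpace ℝ (Fin (n + 1))) 1) :
    Function.Injective (fderiv ℝ
      (fun w => ((extChartAt (𝓡 n) s).symm w : EuclideanSpace ℝ (Fin (n + 1))))
      (extChartAt (𝓡 n) s s)) := by
  have : Fact (Module.finrank ℝ (EuclideanSpace ℝ (Fin (n + 1))) = n + 1) := ⟨by simp⟩
  have h := injective_mvfderiv_subtypeVal_sphere (n := n) s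
  rw [((contMDiff_coe_sphere (m := 1) s).mdifferentiableAt one_ne_zero).mvfderiv] at h
  simp only [modelWithCornersSelf_coe, Set.range_id, fderivWithin_univ] at h
  exact h

theorem Q.contDiffAt_param (p : Q n r) :
    ContDiffAt ℝ ∞ (Q.param p) (extChartAt 𝓘(ℝ, ℝ × EuclideanSpace ℝ (Fin n)) p p) := by
  refine ContDiffAt.congr_of_eventuallyEq ?_ (Q.param_eventuallyEq p)
  refine contDiffAt_fst.prodMk (ContDiffAt.fun_smul ?_ ?_)
  · exact ContDiffAt.comp (g := r) _ (AdmissibleFunction.contDiffAt p.2.1) contDiffAt_fst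
  · exact ContDiffAt.comp (g := fun w => ((extChartAt (𝓡 n) (Q.homeomorph n r p).2).symm w :
      EuclideanSpace ℝ (Fin (n + 1)))) _ (contDiffAt_sphere_chart_symm _) contDiffAt_snd

/-- The time component of the differential recovers `a.1`; once it is zero, what remains is `r`
times the injective differential of the inverse sphere chart. -/
theorem Q.fderiv_param_injective (p : Q n r) : Function.Injective
    (fderiv ℝ (Q.param p) (extChartAt 𝓘(ℝ, ℝ × EuclideanSpace ℝ (Fin n)) p p)) := by
  set y := extChartAt 𝓘(ℝ, ℝ × EuclideanSpace ℝ (Fin n)) p p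
  set s := (Q.homeomorph n r p).2
  have hr : HasFDerivAt (fun y : ℝ × EuclideanSpace ℝ (Fin n) => r y.1) _ y :=
    HasFDerivAt.comp (g := r) y
      ((AdmissibleFunction.contDiffAt p.2.1).differentiableAt (by simp)).hasFDerivAt hasFDerivAt_fst
  have hκ : HasFDerivAt (fun y : ℝ × EuclideanSpace ℝ (Fin n) =>
      ((extChartAt (𝓡 n) s).symm y.2 : EuclideanSpace ℝ (Fin (n + 1)))) _ y :=
    HasFDerivAt.comp (g := fun w => ((extChartAt (𝓡 n) s).symm w :
      EuclideanSpace ℝ (Fin (n + 1)))) y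
      ((contDiffAt_sphere_chart_symm s).differentiableAt (by simp)).hasFDerivAt hasFDerivAt_snd
  have h := (hasFDerivAt_fst.prodMk (hr.smul hκ)).congr_of_eventuallyEq (Q.param_eventuallyEq p)
  rw [h.fderiv]
  refine (injective_iff_map_eq_zero _).2 fun a ha => ?_
  have h1 : a.1 = 0 := congrArg Prod.fst ha
  have h2 := congrArg Prod.snd ha
  have hrp : r y.1 ≠ 0 := (r.pos _ p.2.1).ne'
  simp [h1, hrp] at h2
  exact Prod.ext h1 (fderiv_sphere_chart_symm_injective s (h2.trans (map_zero _).symm))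

theorem Q.contMDiff_coe :
    ContMDiff 𝓘(ℝ, ℝ × EuclideanSpace ℝ (Fin n)) 𝓘(ℝ, Minkowski n) ∞
      (Subtype.val : Q n r → Minkowski n) := fun p =>
  contMDiffAt_iff.2 ⟨continuous_subtype_val.continuousAt, (Q.contDiffAt_param p).contDiffWithinAt⟩

/-- Pulling back twice is pulling back along the composite. A neighbourhood is needed because the
Christoffel map differentiates the metric. -/
theorem Q.metricInChart_eventuallyEq (p : Q n r) :
    metricInChart (Q.metric n r) p
      =ᶠ[nhds (extChartAt 𝓘(ℝ, ℝ × EuclideanSpace ℝ (Fin n)) p p)] fun y =>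
        (lorentz n).bilinearComp (fderiv ℝ (Q.param p) y) (fderiv ℝ (Q.param p) y) := by
  filter_upwards [extChartAt_target_mem_nhds (I := 𝓘(ℝ, ℝ × EuclideanSpace ℝ (Fin n))) p] with y hy
  have h1 : MDifferentiableAt 𝓘(ℝ, ℝ × EuclideanSpace ℝ (Fin n))
      𝓘(ℝ, ℝ × EuclideanSpace ℝ (Fin n))
      (extChartAt 𝓘(ℝ, ℝ × EuclideanSpace ℝ (Fin n)) p).symm y :=
    ((contMDiffOn_extChartAt_symm (n := ∞) p).contMDiffAt
      ((isOpen_extChartAt_target p).mem_nhds hy)).mdifferentiableAt (by simp)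
  have h2 := mfderiv_comp y ((Q.contMDiff_coe (n := n) (r := r) _).mdifferentiableAt (by simp)) h1
  have h3 : fderiv ℝ (Q.param p) y = _ := mfderiv_eq_fderiv.symm.trans h2
  rw [h3]
  rfl

theorem lorentz_fieldP_self {z : Minkowski n} (hz : z ∈ Q n r) :
    lorentz n (fieldP r z) (fieldP r z) = r z.1 ^ 2 * (1 - deriv r z.1 ^ 2) := by
  rw [lorentz_apply]
  simp only [fieldP, real_inner_self_eq_norm_sq]
  rw [hz.2]; ring

theorem one_sub_deriv_sq_pos {t : ℝ} (ht : t ∈ r.domain) : 0 < 1 - deriv r t ^ 2 := by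
  have := (sq_lt_one_iff_abs_lt_one _).2 (r.abs_deriv_lt t ht)
  linarith

/-- `P` is spacelike, hence non-null; this is where `r > 0` and `|r'| < 1` enter. -/
theorem lorentz_fieldP_self_pos {z : Minkowski n} (hz : z ∈ Q n r) :
    0 < lorentz n (fieldP r z) (fieldP r z) := by
  rw [lorentz_fieldP_self hz]
  exact mul_pos (pow_pos (r.pos _ hz.1) 2) (one_sub_deriv_sq_pos hz.1)

/-- The field `P` is normal along maps into `Q(r)`. -/
theorem lorentz_fieldP_fderiv {E : Type*} [NormedAddCommGroup E] [NormedSpace ℝ E]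
    {f : E → Minkowski n} (hmem : ∀ z, f z ∈ Q n r) {y : E} (hf : DifferentiableAt ℝ f y) (a : E) :
    lorentz n (fieldP r (f y)) (fderiv ℝ f y a) = 0 := by
  have h1 : HasFDerivAt (fun z => (f z).1) _ y :=
    HasFDerivAt.comp (g := Prod.fst) y hasFDerivAt_fst hf.hasFDerivAt
  have h2 : HasFDerivAt (fun z => (f z).2) _ y :=
    HasFDerivAt.comp (g := Prod.snd) y hasFDerivAt_snd hf.hasFDerivAt
  have h3 := ((AdmissibleFunction.contDiffAt (hmem y).1).differentiableAt
    (by simp)).hasDerivAt.comp_hasFDerivAt y h1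
  -- `‖x‖² - r(t)²` vanishes along `f`, and half its derivative is the product with `P`.
  have h4 := (h2.inner ℝ h2).sub (h3.mul h3)
  have h5 : (fun z => ⟪(f z).2, (f z).2⟫_ℝ - (r ∘ fun z => (f z).1) z * (r ∘ fun z => (f z).1) z)
      = fun _ => 0 := by
    funext z
    rw [real_inner_self_eq_norm_sq, (hmem z).2]; simp; ring
  have h6 := congrArg (fun l : E →L[ℝ] ℝ => l a) (h4.unique (h5 ▸ hasFDerivAt_const (0 : ℝ) y))
  simp at h6
  have h7 := real_inner_comm (fderiv ℝ f y a).2 (f y).2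
  rw [lorentz_apply]
  simp only [fieldP]
  linarith

/-- The component along `P` of the second derivative of a map into `Q(r)`. -/
theorem lorentz_fieldP_fderiv_fderiv {E : Type*} [NormedAddCommGroup E] [NormedSpace ℝ E]
    {f : E → Minkowski n} (hmem : ∀ z, f z ∈ Q n r) {y : E} (hf : ContDiffAt ℝ 2 f y) (a b : E) :
    lorentz n (fieldP r (f y)) (fderiv ℝ (fderiv ℝ f) y a b) =
      (deriv (deriv r) (f y).1 * r (f y).1 + deriv r (f y).1 ^ 2 - 1)
          * ((fderiv ℝ f y a).1 * (fderiv ℝ f y b).1)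
        - lorentz n (fderiv ℝ f y a) (fderiv ℝ f y b) := by
  have hfd : DifferentiableAt ℝ f y := hf.differentiableAt (by norm_num)
  have hd : DifferentiableAt ℝ (fderiv ℝ f) y :=
    (hf.fderiv_right (m := 1) (by norm_num)).differentiableAt (by norm_num)
  have h1 : HasFDerivAt (fun z => (f z).1) _ y :=
    HasFDerivAt.comp (g := Prod.fst) y hasFDerivAt_fst hfd.hasFDerivAt
  have h2 : HasFDerivAt (fun z => (f z).2) _ y :=
    HasFDerivAt.comp (g := Prod.snd) y hasFDerivAt_snd hfd.hasFDerivAt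
  have h3 := ((AdmissibleFunction.contDiffAt (hmem y).1).differentiableAt
    (by simp)).hasDerivAt.comp_hasFDerivAt y h1
  have h4 := (AdmissibleFunction.deriv_differentiableAt (hmem y).1).hasDerivAt.comp_hasFDerivAt y h1
  have h5 : HasFDerivAt (fun z => fderiv ℝ f z b)
      ((ContinuousLinearMap.apply ℝ (Minkowski n) b).comp (fderiv ℝ (fderiv ℝ f) y)) y :=
    (ContinuousLinearMap.hasFDerivAt (x := fderiv ℝ f y)
      (ContinuousLinearMap.apply ℝ (Minkowski n) b)).comp y hd.hasFDerivAt
  have h6 : HasFDerivAt (fun z => fieldP r (f z)) _ y := (h3.mul h4).prodMk h2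
  have h7 := (lorentz n).hasFDerivAt_of_bilinear h6 h5
  -- Differentiating this identity in direction `a` gives `⟨P, D²f(a, b)⟩ = -⟨dP(Df a), Df b⟩`. The
  -- `-1` in the coefficient comes from writing the Euclidean product of spatial parts through the
  -- Lorentz product.
  have hev : (fun z => lorentz n (fieldP r (f z)) (fderiv ℝ f z b)) =ᶠ[nhds y] fun _ => 0 := by
    filter_upwards [hf.eventually (by simp)] with z hz
    exact lorentz_fieldP_fderiv hmem (hz.differentiableAt (by norm_num)) b
  have h8 := congrArg (fun l : E →L[ℝ] ℝ => l a)
    (h7.unique ((hasFDerivAt_const (0 : ℝ) y).congr_of_eventuallyEq hev))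
  simp [lorentz_apply] at h8
  simp only [lorentz_apply]
  linarith

end Hypersurface

theorem fderiv_fderiv_comp {E F W : Type*} [NormedAddCommGroup E] [NormedSpace ℝ E]
    [NormedAddCommGroup F] [NormedSpace ℝ F] [NormedAddCommGroup W] [NormedSpace ℝ W]
    {g : F → W} {f : E → F} {y : E} (hg : ContDiffAt ℝ 2 g (f y)) (hf : ContDiffAt ℝ 2 f y)
    (u v : E) : fderiv ℝ (fderiv ℝ (g ∘ f)) y u v =
      fderiv ℝ (fderiv ℝ g) (f y) (fderiv ℝ f y u) (fderiv ℝ f y v)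
        + fderiv ℝ g (f y) (fderiv ℝ (fderiv ℝ f) y u v) := by
  have hgd : DifferentiableAt ℝ (fderiv ℝ g) (f y) :=
    (hg.fderiv_right (m := 1) (by norm_num)).differentiableAt (by norm_num)
  have hfd : DifferentiableAt ℝ (fderiv ℝ f) y :=
    (hf.fderiv_right (m := 1) (by norm_num)).differentiableAt (by norm_num)
  have hev : fderiv ℝ (g ∘ f) =ᶠ[nhds y] fun z => (fderiv ℝ g (f z)).comp (fderiv ℝ f z) := by
    filter_upwards [hf.eventually (by simp), hf.continuousAt.eventually (hg.eventually (by simp))]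
      with z h1 h2
    exact fderiv_comp z (h2.differentiableAt (by norm_num)) (h1.differentiableAt (by norm_num))
  have h1 : HasFDerivAt (fun z => fderiv ℝ g (f z)) _ y :=
    HasFDerivAt.comp (g := fderiv ℝ g) y hgd.hasFDerivAt
      (hf.differentiableAt (by norm_num)).hasFDerivAt
  rw [hev.fderiv_eq, (h1.clm_comp hfd.hasFDerivAt).fderiv]
  simp [add_comm]

/-! ### Spacelike immersions into `Q(r)` -/

section Immersion

variable {n k : ℕ} {r : AdmissibleFunction}
  {M : Type*} [TopologicalSpace M] [ChartedSpace (EuclideanSpace ℝ (Fin k)) M]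
  {Ψ : M → Q n r}

theorem IsSpacelikeImmersion.contDiffAt_writtenInExtChartAt (hΨ : IsSpacelikeImmersion k Ψ)
    (x : M) : ContDiffAt ℝ ∞
      (writtenInExtChartAt (𝓡 k) 𝓘(ℝ, ℝ × EuclideanSpace ℝ (Fin n)) x Ψ)
      (extChartAt (𝓡 k) x x) := by
  have h := (contMDiffAt_iff.1 (hΨ.contMDiff x)).2
  simp only [modelWithCornersSelf_coe, Set.range_id, contDiffWithinAt_univ] at h
  exact h

theorem writtenInExtChartAt_self (x : M) :
    writtenInExtChartAt (𝓡 k) 𝓘(ℝ, ℝ × EuclideanSpace ℝ (Fin n)) x Ψ (extChartAt (𝓡 k) x x)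
      = extChartAt 𝓘(ℝ, ℝ × EuclideanSpace ℝ (Fin n)) (Ψ x) (Ψ x) := by
  rw [writtenInExtChartAt, Function.comp_apply, Function.comp_apply, extChartAt_to_inv]

/-- The chart at `Ψ x` is inverted only on its source, which `Ψ` stays in near `x` by continuity. It
reduces the Hessian of the position vector to a chain rule between vector spaces. -/
theorem IsSpacelikeImmersion.position_comp_eventuallyEq (hΨ : IsSpacelikeImmersion k Ψ) (x : M) :
    position Ψ ∘ (extChartAt (𝓡 k) x).symm =ᶠ[nhds (extChartAt (𝓡 k) x x)]
      Q.param (Ψ x) ∘ writtenInExtChartAt (𝓡 k) 𝓘(ℝ, ℝ × EuclideanSpace ℝ (Fin n)) x Ψ := by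
  have hc : ContinuousAt (Ψ ∘ (extChartAt (𝓡 k) x).symm) (extChartAt (𝓡 k) x x) := by
    refine ContinuousAt.comp ?_ (continuousAt_extChartAt_symm x)
    rw [extChartAt_to_inv]
    exact hΨ.contMDiff.continuous.continuousAt
  have hs : (extChartAt 𝓘(ℝ, ℝ × EuclideanSpace ℝ (Fin n)) (Ψ x)).source ∈
      nhds ((Ψ ∘ (extChartAt (𝓡 k) x).symm) (extChartAt (𝓡 k) x x)) := by
    rw [Function.comp_apply, extChartAt_to_inv]
    exact extChartAt_source_mem_nhds _
  filter_upwards [hc.eventually hs] with z hz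
  exact congrArg Subtype.val
    ((extChartAt 𝓘(ℝ, ℝ × EuclideanSpace ℝ (Fin n)) (Ψ x)).left_inv hz).symm

/-- The differential of `Ψ` at `x` as a map to `L^{n+2}`. -/
noncomputable def differential (Ψ : M → Q n r) (x : M) :
    EuclideanSpace ℝ (Fin k) →L[ℝ] Minkowski n :=
  (fderiv ℝ (Q.param (Ψ x)) (extChartAt 𝓘(ℝ, ℝ × EuclideanSpace ℝ (Fin n)) (Ψ x) (Ψ x))).comp
    (fderiv ℝ (writtenInExtChartAt (𝓡 k) 𝓘(ℝ, ℝ × EuclideanSpace ℝ (Fin n)) x Ψ)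
      (extChartAt (𝓡 k) x x))

theorem IsSpacelikeImmersion.mfderiv_eq (hΨ : IsSpacelikeImmersion k Ψ) (x : M) :
    mfderiv (𝓡 k) 𝓘(ℝ, ℝ × EuclideanSpace ℝ (Fin n)) Ψ x =
      fderiv ℝ (writtenInExtChartAt (𝓡 k) 𝓘(ℝ, ℝ × EuclideanSpace ℝ (Fin n)) x Ψ)
        (extChartAt (𝓡 k) x x) := by
  rw [((hΨ.contMDiff x).mdifferentiableAt (by simp)).mfderiv]
  simp only [modelWithCornersSelf_coe, Set.range_id, fderivWithin_univ]
  rfl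

theorem Q.mfderiv_coe (p : Q n r) :
    mfderiv 𝓘(ℝ, ℝ × EuclideanSpace ℝ (Fin n)) 𝓘(ℝ, Minkowski n)
      (Subtype.val : Q n r → Minkowski n) p =
      fderiv ℝ (Q.param p) (extChartAt 𝓘(ℝ, ℝ × EuclideanSpace ℝ (Fin n)) p p) := by
  rw [((Q.contMDiff_coe p).mdifferentiableAt (by simp)).mfderiv]
  simp only [modelWithCornersSelf_coe, Set.range_id, fderivWithin_univ]
  rfl

theorem IsSpacelikeImmersion.inducedMetric_apply (hΨ : IsSpacelikeImmersion k Ψ) (x : M)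
    (u v : EuclideanSpace ℝ (Fin k)) :
    inducedMetric k Ψ x u v = lorentz n (differential Ψ x u) (differential Ψ x v) := by
  have h : inducedMetric k Ψ x u v = lorentz n
      (mfderiv 𝓘(ℝ, ℝ × EuclideanSpace ℝ (Fin n)) 𝓘(ℝ, Minkowski n)
        (Subtype.val : Q n r → Minkowski n) (Ψ x)
          (mfderiv (𝓡 k) 𝓘(ℝ, ℝ × EuclideanSpace ℝ (Fin n)) Ψ x u))
      (mfderiv 𝓘(ℝ, ℝ × EuclideanSpace ℝ (Fin n)) 𝓘(ℝ, Minkowski n)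
        (Subtype.val : Q n r → Minkowski n) (Ψ x)
          (mfderiv (𝓡 k) 𝓘(ℝ, ℝ × EuclideanSpace ℝ (Fin n)) Ψ x v)) := rfl
  rw [h, Q.mfderiv_coe, hΨ.mfderiv_eq]
  rfl

theorem IsSpacelikeImmersion.mfderiv_timeComponent (hΨ : IsSpacelikeImmersion k Ψ) (x : M) :
    mfderiv (𝓡 k) 𝓘(ℝ, ℝ) (timeComponent Ψ) x =
      (ContinuousLinearMap.fst ℝ ℝ (EuclideanSpace ℝ (Fin (n + 1)))).comp (differential Ψ x) := by
  have h1 : MDifferentiableAt (𝓡 k) 𝓘(ℝ, ℝ × EuclideanSpace ℝ (Fin n)) Ψ x :=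
    (hΨ.contMDiff x).mdifferentiableAt (by simp)
  have h2 : MDifferentiableAt 𝓘(ℝ, ℝ × EuclideanSpace ℝ (Fin n)) 𝓘(ℝ, Minkowski n)
      (Subtype.val : Q n r → Minkowski n) (Ψ x) :=
    (Q.contMDiff_coe _).mdifferentiableAt (by simp)
  have h3 : MDifferentiableAt 𝓘(ℝ, Minkowski n) 𝓘(ℝ, ℝ) (Prod.fst : Minkowski n → ℝ)
      (position Ψ x) := (differentiableAt_fst (𝕜 := ℝ)).mdifferentiableAt
  have h4 := mfderiv_comp x h3 (h2.comp x h1)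
  have h5 := mfderiv_comp x h2 h1
  rw [Q.mfderiv_coe, hΨ.mfderiv_eq] at h5
  rw [mfderiv_eq_fderiv, fderiv_fst] at h4
  exact h4.trans (congrArg _ h5)

theorem IsSpacelikeImmersion.inducedMetric_nondegenerate (hΨ : IsSpacelikeImmersion k Ψ) (x : M)
    (u : EuclideanSpace ℝ (Fin k)) (hu : ∀ v, inducedMetric k Ψ x u v = 0) : u = 0 := by
  by_contra h
  exact (hΨ.pos_def x u h).ne' (hu u)

theorem IsSpacelikeImmersion.gradientNormSq_timeComponent (hΨ : IsSpacelikeImmersion k Ψ) (x : M) :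
    gradientNormSq (inducedMetric k Ψ) (timeComponent Ψ) x =
      metricTrace (inducedMetric k Ψ x)
        (fun u v => (differential Ψ x u).1 * (differential Ψ x v).1) := by
  have h := metricTrace_mul_self (inducedMetric k Ψ x) (hΨ.inducedMetric_nondegenerate x)
    ((ContinuousLinearMap.fst ℝ ℝ (EuclideanSpace ℝ (Fin (n + 1)))).comp (differential Ψ x))
  refine Eq.trans ?_ h.symm
  rw [← hΨ.mfderiv_timeComponent]
  rfl

/-- The second fundamental form of `Q(r)` in `L^{n+2}`. -/
theorem Q.second_fundamental_form (p : Q n r) (a b : ℝ × EuclideanSpace ℝ (Fin n)) :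
    letI y := extChartAt 𝓘(ℝ, ℝ × EuclideanSpace ℝ (Fin n)) p p
    letI D := fderiv ℝ (Q.param p) y
    fderiv ℝ (fderiv ℝ (Q.param p)) y a b - D (christoffel (metricInChart (Q.metric n r) p) y a b) =
      (((deriv (deriv r) p.1.1 * r p.1.1 + deriv r p.1.1 ^ 2 - 1) * ((D a).1 * (D b).1)
        - lorentz n (D a) (D b)) / (r p.1.1 ^ 2 * (1 - deriv r p.1.1 ^ 2))) • fieldP r p.1 := by
  have hC := (Q.contDiffAt_param p).of_le (m := 2) ENat.LEInfty.out
  have hd := hC.differentiableAt (by norm_num)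
  have hP := lorentz_fieldP_self_pos p.2
  have hnormal := fun a => lorentz_fieldP_fderiv (Q.param_mem p) hd a
  have hII := lorentz_fieldP_fderiv_fderiv (Q.param_mem p) hC a b
  simp only [Q.param_extChartAt] at hnormal hII
  have hev := Q.metricInChart_eventuallyEq p
  have hnd : ∀ u, (∀ v, metricInChart (Q.metric n r) p
      (extChartAt 𝓘(ℝ, ℝ × EuclideanSpace ℝ (Fin n)) p p) u v = 0) → u = 0 := by
    intro u hu
    rw [hev.eq_of_nhds] at hu
    -- A tangent vector orthogonal to all tangent vectors is a multiple of `P`, with coefficient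
    -- zero since `P` is normal.
    have := eq_smul_of_lorentz_eq_zero (Q.fderiv_param_injective p) hP.ne' hnormal hu
    have hu₀ : fderiv ℝ (Q.param p) _ u = 0 :=
      this.trans ((congrArg (fun c : ℝ => (c / _) • fieldP r p.1) (hnormal u)).trans (by simp))
    exact Q.fderiv_param_injective p (hu₀.trans (map_zero _).symm)
  have h := eq_smul_of_lorentz_eq_zero (Q.fderiv_param_injective p) hP.ne' hnormal
    (gauss_formula (lorentz_symm n) hC hev hnd a b)
  rw [map_sub, hnormal, sub_zero, hII, lorentz_fieldP_self p.2] at h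
  exact h

/-- The Hessian of the position vector splits into the second fundamental form of `Ψ` in `Q(r)` and
that of `Q(r)` in `L^{n+2}`. -/
theorem IsSpacelikeImmersion.hessian_position (hΨ : IsSpacelikeImmersion k Ψ) (x : M)
    (u v : EuclideanSpace ℝ (Fin k)) :
    hessian (inducedMetric k Ψ) (position Ψ) x u v =
      fderiv ℝ (Q.param (Ψ x)) (extChartAt 𝓘(ℝ, ℝ × EuclideanSpace ℝ (Fin n)) (Ψ x) (Ψ x))
        (secondFundamentalForm (inducedMetric k Ψ) (Q.metric n r) Ψ x u v) +
      (((deriv (deriv r) (timeComponent Ψ x) * r (timeComponent Ψ x)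
          + deriv r (timeComponent Ψ x) ^ 2 - 1)
            * ((differential Ψ x u).1 * (differential Ψ x v).1)
        - inducedMetric k Ψ x u v)
        / (r (timeComponent Ψ x) ^ 2 * (1 - deriv r (timeComponent Ψ x) ^ 2))) •
          fieldP r (position Ψ x) := by
  have hev := hΨ.position_comp_eventuallyEq x
  have hF := (hΨ.contDiffAt_writtenInExtChartAt x).of_le (m := 2) ENat.LEInfty.out
  have hι := (Q.contDiffAt_param (Ψ x)).of_le (m := 2) ENat.LEInfty.out
  rw [← writtenInExtChartAt_self (k := k) x] at hι
  have h := Q.second_fundamental_form (Ψ x)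
    (fderiv ℝ (writtenInExtChartAt (𝓡 k) 𝓘(ℝ, ℝ × EuclideanSpace ℝ (Fin n)) x Ψ)
      (extChartAt (𝓡 k) x x) u)
    (fderiv ℝ (writtenInExtChartAt (𝓡 k) 𝓘(ℝ, ℝ × EuclideanSpace ℝ (Fin n)) x Ψ)
      (extChartAt (𝓡 k) x x) v)
  rw [hΨ.inducedMetric_apply]
  refine Eq.trans ?_ (congrArg _ h)
  simp only [hessian, secondFundamentalForm]
  -- After the chain rule the Christoffel term of `Q(r)` cancels, and that of `M` occurs identically
  -- on both sides, so it is never computed.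
  rw [hev.fderiv.fderiv_eq, hev.fderiv_eq, fderiv_fderiv_comp hι hF,
    fderiv_comp _ (hι.differentiableAt (by norm_num)) (hF.differentiableAt (by norm_num)),
    writtenInExtChartAt_self]
  simp only [ContinuousLinearMap.comp_apply, map_add, map_sub]
  abel

/-- Trace of the Hessian splitting: the `P`-coefficient sums to `-q`, and `dι` commutes with the
finite sum. -/
theorem IsSpacelikeImmersion.laplacian_position (hΨ : IsSpacelikeImmersion k Ψ) (x : M) :
    laplacian (inducedMetric k Ψ) (position Ψ) x =
      fderiv ℝ (Q.param (Ψ x)) (extChartAt 𝓘(ℝ, ℝ × EuclideanSpace ℝ (Fin n)) (Ψ x) (Ψ x))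
        (metricTrace (W := ℝ × EuclideanSpace ℝ (Fin n)) (inducedMetric k Ψ x)
          (secondFundamentalForm (inducedMetric k Ψ) (Q.metric n r) Ψ x))
      - qFunction k Ψ x • fieldP r (position Ψ x) := by
  have hk := metricTrace_self (inducedMetric k Ψ x)
    (fun u v => by rw [hΨ.inducedMetric_apply, hΨ.inducedMetric_apply, lorentz_symm])
    (hΨ.inducedMetric_nondegenerate x)
  rw [qFunction, hΨ.gradientNormSq_timeComponent, ← hk, sub_eq_add_neg, ← neg_smul]
  simp only [laplacian, metricTrace, hΨ.hessian_position, Finset.sum_add_distrib,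
    ← Finset.sum_smul, ← Finset.sum_div, Finset.sum_sub_distrib, ← Finset.mul_sum]
  rw [← neg_div, neg_sub]
  exact congrArg (· + _) (map_sum _ _ _).symm

theorem IsSpacelikeImmersion.isStationary_iff (hΨ : IsSpacelikeImmersion k Ψ) :
    IsStationaryImmersion k Ψ ↔ ∀ x : M,
      laplacian (inducedMetric k Ψ) (position Ψ) x
        + qFunction k Ψ x • fieldP r (position Ψ x) = 0 := by
  refine forall_congr' fun x => ?_
  rw [hΨ.laplacian_position, sub_add_cancel,
    map_eq_zero_iff _ (Q.fderiv_param_injective (Ψ x))]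
  change (1 / k : ℝ) • metricTrace (W := ℝ × EuclideanSpace ℝ (Fin n)) (inducedMetric k Ψ x)
    (secondFundamentalForm (inducedMetric k Ψ) (Q.metric n r) Ψ x) = 0 ↔ _
  rcases Nat.eq_zero_or_pos k with rfl | hk
  -- For `k = 0` the factor `1 / k` is `0` and the trace is an empty sum, so both sides hold.
  · rw [Nat.cast_zero, div_zero, zero_smul]
    exact iff_of_true rfl Finset.sum_empty
  · have : (1 / k : ℝ) ≠ 0 := by positivity
    rw [smul_eq_zero_iff_right this]

/-- `N = -α P`, so `α N = -α² P` with `α² = 1 / (r²(1 - r'²))`. -/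
theorem alpha_smul_unitNormal {z : Minkowski n} (hz : z ∈ Q n r) (c : ℝ) :
    (alpha r z.1 * c) • unitNormal r z =
      -((c / (r z.1 ^ 2 * (1 - deriv r z.1 ^ 2))) • fieldP r z) := by
  have h1 := r.pos _ hz.1
  have h2 := one_sub_deriv_sq_pos hz.1
  have h3 : √(1 - deriv r z.1 ^ 2) ^ 2 = 1 - deriv r z.1 ^ 2 := Real.sq_sqrt h2.le
  have h4 : √(1 - deriv r z.1 ^ 2) ≠ 0 := (Real.sqrt_pos.2 h2).ne'
  rw [unitNormal, fieldP, alpha, smul_smul, ← neg_smul, mul_comm (r z.1) (deriv r z.1)]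
  congr 1
  conv_rhs => rw [← h3]
  field_simp

end Immersion

end RWSpacetime

open RWSpacetime in
theorem proposition4 (n k : ℕ) (r : AdmissibleFunction)
    {M : Type*} [TopologicalSpace M] [ChartedSpace (EuclideanSpace ℝ (Fin k)) M]
    [IsManifold (𝓡 k) ∞ M] (Ψ : M → Q n r) (hΨ : IsSpacelikeImmersion k Ψ) :
    (IsStationaryImmersion k Ψ ↔
      ∀ x : M, laplacian (inducedMetric k Ψ) (position Ψ) x =
        (alpha r (timeComponent Ψ x) *
          (k - (deriv (deriv r) (timeComponent Ψ x) * r (timeComponent Ψ x)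
              + deriv r (timeComponent Ψ x) ^ 2 - 1)
            * gradientNormSq (inducedMetric k Ψ) (timeComponent Ψ) x)) •
          unitNormal r (position Ψ x)) ∧
    (IsStationaryImmersion k Ψ ↔
      ∀ x : M, laplacian (inducedMetric k Ψ) (position Ψ) x
        + qFunction k Ψ x • fieldP r (position Ψ x) = 0) := by
  refine ⟨hΨ.isStationary_iff.trans (forall_congr' fun x => ?_), hΨ.isStationary_iff⟩
  rw [add_eq_zero_iff_eq_neg]
  exact Eq.congr rfl (alpha_smul_unitNormal (Ψ x).2 _).symm
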